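/- Let $V$ be a real Hilbert space and let $\Gamma\subseteq\mathbb{R}$ be measurable. Let $\delta>0$ if $\Gamma$ is unbounded and $\delta=0$ if $\Gamma$ is bounded. Let $\rho:\Gamma\to[0,\infty)$ be a measurable weight with $\rho(y)\le C^M e^{-(\delta y)^2}$ for all $y\in\Gamma$, for some constant $C^M>0$. Put $\varsigma(y):=e^{-(\delta y)^2/4}$ (so $\varsigma\equiv 1$ if $\Gamma$ is bounded), and let $C^0_\varsigma(\Gamma;V)$ be the space of continuous functions $v:\Gamma\to V$ with $$\|v\|_{C^0_\varsigma(\Gamma;V)}:=\sup_{y\in\Gamma}\varsigma(y)\,\|v(y)\|_V<\infty ,$$ and let $L^2_\rho(\Gamma;V)$ be the space of square-integrable $V$-valued functions with respect to the measure $\rho(y)\,dy$ on $\Gamma$. For $p\in\mathbb{N}=\{0,1,2,\dots\}$ let $y_1,\dots,y_{p+1}\in\Gamma$ denote the zeros (counted with multiplicity) of a polynomial $q$ of degree $p+1$ which satisfies $\int_\Gamma q(y)\,r(y)\,\rho(y)\,dy=0$ for all real polynomials $r$ of degree at most $p$; for each $p$ for which such points in $\Gamma$ exist, let $$\mathcal{I}_p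 v(y):=\sum_{j=1}^{p+1} v(y_j)\,\ell_j(y),\qquad \ell_j(y):=\prod_{k\ne j}\frac{y-y_k}{y_j-y_k},$$ be the Lagrange interpolation operator at these points. (The zeros are automatically distinct unless $\rho=0$ a.e., in which case $L^2_\rho(\Gamma;V)=\{0\}$.) Then $\mathcal{I}_p: C^0_\varsigma(\Gamma;V)\to L^2_\rho(\Gamma;V)$ is a continuous linear operator, and there is a constant $C>0$, independent of $p$, of the choice of the points $y_j$, and of $v$, such that $$\|\mathcal{I}_p v\|_{L^2_\rho(\Gamma;V)}\le C\,\|v\|_{C^0_\varsigma(\Gamma;V)}\qquad\text{for all } v\in C^0_\varsigma(\Gamma;V).$$ -/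

import Mathlib

open MeasureTheory Polynomial

/-- The Gaussian weight `ς(y) = exp (-(δ y)² / 4)`; it is identically `1` for `δ = 0`. -/
noncomputable def varsigma (δ y : ℝ) : ℝ := Real.exp (-(δ * y) ^ 2 / 4)

theorem varsigma_pos (δ y : ℝ) : 0 < varsigma δ y := Real.exp_pos _

/-- The space `C⁰_ς(Γ; V)`: continuous functions `v : Γ → V` for which `ς(y) ‖v(y)‖` is bounded
on `Γ`. -/
def WeightedC0 (δ : ℝ) (Γ : Set ℝ) (V : Type*) [NormedAddCommGroup V] [NormedSpace ℝ V] :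
    Submodule ℝ (Γ → V) where
  carrier := {v | Continuous v ∧ BddAbove (Set.range fun y : Γ => varsigma δ y * ‖v y‖)}
  add_mem' := by
    rintro v w ⟨hv, a, ha⟩ ⟨hw, b, hb⟩
    refine ⟨hv.add hw, a + b, ?_⟩
    rintro _ ⟨y, rfl⟩
    have h1 := ha ⟨y, rfl⟩
    have h2 := hb ⟨y, rfl⟩
    have h3 := mul_le_mul_of_nonneg_left (norm_add_le (v y) (w y)) (varsigma_pos δ y).le
    simp only [Pi.add_apply] at *
    linarith
  zero_mem' := by
    refine ⟨continuous_const, 0, ?_⟩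
    rintro _ ⟨y, rfl⟩
    simp
  smul_mem' := by
    rintro c v ⟨hv, a, ha⟩
    refine ⟨hv.const_smul c, ‖c‖ * a, ?_⟩
    rintro _ ⟨y, rfl⟩
    have h1 := mul_le_mul_of_nonneg_left (ha ⟨y, rfl⟩) (norm_nonneg c)
    simp only [Pi.smul_apply, norm_smul] at *
    linarith

section Norm

variable {δ : ℝ} {Γ : Set ℝ} {V : Type*} [NormedAddCommGroup V] [NormedSpace ℝ V]

/-- The norm `‖v‖ = sup_{y ∈ Γ} ς(y) ‖v(y)‖_V` of `C⁰_ς(Γ; V)`. -/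
noncomputable instance WeightedC0.instNorm : Norm (WeightedC0 δ Γ V) where
  norm v := ⨆ y : Γ, varsigma δ y * ‖(v : Γ → V) y‖

theorem WeightedC0.norm_def (v : WeightedC0 δ Γ V) :
    ‖v‖ = ⨆ y : Γ, varsigma δ y * ‖(v : Γ → V) y‖ := rfl

theorem WeightedC0.le_norm (v : WeightedC0 δ Γ V) (y : Γ) :
    varsigma δ y * ‖(v : Γ → V) y‖ ≤ ‖v‖ :=
  le_ciSup v.2.2 y

theorem WeightedC0.normedSpaceCore : NormedSpace.Core ℝ (WeightedC0 δ Γ V) where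
  norm_nonneg v := Real.iSup_nonneg fun y => mul_nonneg (varsigma_pos δ y).le (norm_nonneg _)
  norm_smul c v := by
    rw [WeightedC0.norm_def, WeightedC0.norm_def, Real.mul_iSup_of_nonneg (norm_nonneg c)]
    refine iSup_congr fun y => ?_
    simp only [Submodule.coe_smul, Pi.smul_apply, norm_smul]
    ring
  norm_triangle v w := by
    have hv : 0 ≤ ‖v‖ := Real.iSup_nonneg fun y =>
      mul_nonneg (varsigma_pos δ y).le (norm_nonneg _)
    have hw : 0 ≤ ‖w‖ := Real.iSup_nonneg fun y =>
      mul_nonneg (varsigma_pos δ y).le (norm_nonneg _)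
    refine Real.iSup_le (fun y => ?_) (add_nonneg hv hw)
    have h1 := WeightedC0.le_norm v y
    have h2 := WeightedC0.le_norm w y
    have h3 := mul_le_mul_of_nonneg_left (norm_add_le ((v : Γ → V) y) ((w : Γ → V) y))
      (varsigma_pos δ y).le
    simp only [Submodule.coe_add, Pi.add_apply]
    linarith
  norm_eq_zero_iff v := by
    constructor
    · intro h
      ext y
      have h1 := WeightedC0.le_norm v y
      rw [h] at h1
      have h2 : ‖(v : Γ → V) y‖ ≤ 0 := nonpos_of_mul_nonpos_right h1 (varsigma_pos δ y)
      simpa using h2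
    · rintro rfl
      simp [WeightedC0.norm_def]

noncomputable instance WeightedC0.instNormedAddCommGroup :
    NormedAddCommGroup (WeightedC0 δ Γ V) :=
  NormedAddCommGroup.ofCore WeightedC0.normedSpaceCore

noncomputable instance WeightedC0.instNormedSpace : NormedSpace ℝ (WeightedC0 δ Γ V) :=
  NormedSpace.ofCore WeightedC0.normedSpaceCore

end Norm

/-- The measure `ρ(y) dy` on `Γ`; the space `L²_ρ(Γ; V)` is `Lp V 2 (weightMeasure Γ ρ)`. -/
noncomputable def weightMeasure (Γ : Set ℝ) (ρ : ℝ → ℝ) : Measure ℝ :=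
  (volume.restrict Γ).withDensity fun y => ENNReal.ofReal (ρ y)

/-- The points `y 0, …, y p` of `Γ` are the zeros, counted with multiplicity, of a polynomial of
degree `p + 1` that is orthogonal with respect to the weight `ρ` on `Γ` to all polynomials of degree
at most `p`. -/
def IsGaussNodes (Γ : Set ℝ) (ρ : ℝ → ℝ) (p : ℕ) (y : Fin (p + 1) → Γ) : Prop :=
  ∃ q : ℝ[X], q.natDegree = p + 1 ∧
    (∀ r : ℝ[X], r.natDegree ≤ p → ∫ t in Γ, q.eval t * r.eval t * ρ t = 0) ∧
    q.roots = Finset.univ.val.map fun j => (y j : ℝ)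

/-- The Lagrange interpolant `t ↦ ∑ⱼ ℓⱼ(t) v(yⱼ)` of `v : Γ → V` at the nodes `yⱼ ∈ Γ`, where
`ℓⱼ(t) = ∏_{k ≠ j} (t - yₖ) / (yⱼ - yₖ)`. -/
noncomputable def lagrangeInterp {Γ : Set ℝ} {V : Type*} [NormedAddCommGroup V] [NormedSpace ℝ V]
    {p : ℕ} (y : Fin (p + 1) → Γ) (v : Γ → V) (t : ℝ) : V :=
  ∑ j, (Lagrange.basis Finset.univ (fun k => (y k : ℝ)) j).eval t • v (y j)

/-! Write μ = ρ dy, n = p + 1 and w_j = ∫ ℓ_j dμ. Gaussian quadrature ∑ w_j P(y_j) is exact for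
degree < 2n (`integral_eval_eq_sum_gauss`), so the ℓ_j are orthogonal in L²(μ) with ‖ℓ_j‖² = w_j ≥
0. Since ς⁻² = exp(δ²y²/2), this gives ‖I_p v‖² = ∑ w_j ‖v(y_j)‖² ≤ ‖v‖² ∑ w_j exp(δ²y_j²/2).

The last sum is bounded uniformly in p by ∫ exp(δ²t²/2) dμ (`sum_gauss_exp_le_integral`): the
quadrature error of f has the sign of its derivative of order 2n, and the Taylor polynomials of
exp(at²) at 0 have nonnegative derivatives of every even order. The integral is finite because ρ
decays like exp(-δ²y²), or because Γ is bounded. Coinciding nodes force μ = 0, where nothing is left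
to prove. -/

/-! ### Roots of iterated derivatives. -/

theorem Polynomial.card_roots_le_iterate_derivative (P : ℝ[X]) (m : ℕ) :
    Multiset.card P.roots ≤ Multiset.card (derivative^[m] P).roots + m := by
  induction m with
  | zero => simp
  | succ m ih =>
    rw [Function.iterate_succ_apply']
    have := card_roots_le_derivative (derivative^[m] P)
    omega

/-- Rolle's theorem with multiplicities. -/
theorem Polynomial.exists_isRoot_iterate_derivative {P Q : ℝ[X]} (hQP : Q ∣ P) {m : ℕ}
    (hm : m < Multiset.card Q.roots) : ∃ ξ, (derivative^[m] P).eval ξ = 0 := by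
  by_cases hP : P = 0
  · exact ⟨0, by simp [hP]⟩
  have h1 := Multiset.card_le_card (roots.le_of_dvd hP hQP)
  have h2 := card_roots_le_iterate_derivative P m
  obtain ⟨ξ, hξ⟩ := Multiset.card_pos_iff_exists_mem.1
    (show 0 < Multiset.card (derivative^[m] P).roots by omega)
  exact ⟨ξ, isRoot_of_mem_roots hξ⟩

theorem Polynomial.iterate_derivative_natDegree_of_monic {P : ℝ[X]} (hP : P.Monic) :
    derivative^[P.natDegree] P = C (P.natDegree.factorial : ℝ) := by
  ext k
  rw [coeff_iterate_derivative, coeff_C]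
  split_ifs with hk
  · subst hk
    simp [Nat.descFactorial_self, hP.coeff_natDegree]
  · rw [coeff_eq_zero_of_natDegree_lt (by omega), smul_zero]

/-! ### Gaussian quadrature for a measure on the line. -/

section Quadrature

variable {n : ℕ} {x : Fin n → ℝ} {μ : Measure ℝ}

theorem Lagrange.roots_nodal_sq (x : Fin n → ℝ) :
    Multiset.card (Lagrange.nodal Finset.univ x ^ 2).roots = 2 * n := by
  have : (Lagrange.nodal Finset.univ x).roots = Finset.univ.val.map x := by
    rw [Lagrange.nodal_eq, Finset.prod_eq_multiset_prod,
      show (Finset.univ.val.map fun i => X - C (x i)) =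
        (Finset.univ.val.map x).map fun a => X - C a by rw [Multiset.map_map]; rfl,
      roots_multiset_prod_X_sub_C]
  rw [roots_pow, this]
  simp

/-- The remainder in Hermite interpolation has the sign of the derivative of order `2 n`. -/
theorem Polynomial.eval_modByMonic_nodal_sq_le (x : Fin n → ℝ) {f : ℝ[X]}
    (hf : ∀ t, 0 ≤ (derivative^[2 * n] f).eval t) (t : ℝ) :
    (f %ₘ (Lagrange.nodal Finset.univ x ^ 2)).eval t ≤ f.eval t := by
  set q := Lagrange.nodal Finset.univ x with hq
  have hqm : q.Monic := Lagrange.nodal_monic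
  have hq2 : (q ^ 2).Monic := hqm.pow 2
  have hdeg : (q ^ 2).natDegree = 2 * n := by
    rw [hqm.natDegree_pow, hq, Lagrange.natDegree_nodal]; simp
  have hdecomp := modByMonic_add_div f (q ^ 2)
  set H := f %ₘ (q ^ 2) with hH
  set g := f /ₘ (q ^ 2) with hg
  have hev : f.eval t = H.eval t + (q.eval t) ^ 2 * g.eval t := by
    conv_lhs => rw [← hdecomp]
    simp
  rw [hev]
  by_cases hqt : q.eval t = 0
  · simp [hqt]
  -- `F` is divisible by q²(X - t), which has 2n + 1 roots with multiplicity, so its derivative of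
  -- order 2n vanishes at some ξ. There f⁽²ⁿ⁾(ξ) = (2n)! g(t), which gives g(t) ≥ 0.
  set F := f - H - C (g.eval t) * q ^ 2 with hF
  have hF' : F = q ^ 2 * (g - C (g.eval t)) := by
    rw [hF]
    conv_lhs => rw [← hdecomp]
    ring
  have hdvd : q ^ 2 * (X - C t) ∣ F := by
    rw [hF']
    exact mul_dvd_mul_left _ (dvd_iff_isRoot.2 (by simp))
  have hne : q ^ 2 * (X - C t) ≠ 0 := mul_ne_zero hq2.ne_zero (X_sub_C_ne_zero t)
  obtain ⟨ξ, hξ⟩ := exists_isRoot_iterate_derivative hdvd (m := 2 * n) (by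
    rw [roots_mul hne, Multiset.card_add, roots_X_sub_C, hq, Lagrange.roots_nodal_sq]
    simp)
  have hH0 : derivative^[2 * n] H = 0 := by
    refine iterate_derivative_eq_zero_of_degree_lt ?_
    have := degree_modByMonic_lt f hq2
    rwa [degree_eq_natDegree hq2.ne_zero, hdeg] at this
  have hfac : derivative^[2 * n] (q ^ 2) = C ((2 * n).factorial : ℝ) := by
    rw [← hdeg]; exact iterate_derivative_natDegree_of_monic hq2
  rw [hF, iterate_derivative_sub, iterate_derivative_sub, hH0, iterate_derivative_C_mul, hfac] at hξ
  simp only [sub_zero, eval_sub, eval_mul, eval_C] at hξ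
  have h1 := hf ξ
  have h2 : (0 : ℝ) < (2 * n).factorial := by positivity
  have h3 : 0 ≤ g.eval t := by
    by_contra hneg
    have := mul_neg_of_neg_of_pos (not_le.1 hneg) h2
    linarith
  have := mul_nonneg (sq_nonneg (q.eval t)) h3
  linarith

/-- Gaussian quadrature is exact in degrees less than `2 n`. -/
theorem integral_eval_eq_sum_gauss (hx : Function.Injective x)
    (hint : ∀ P : ℝ[X], Integrable (fun t => P.eval t) μ)
    (horth : ∀ r : ℝ[X], r.degree < n →
      ∫ t, (Lagrange.nodal Finset.univ x * r).eval t ∂μ = 0)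
    {P : ℝ[X]} (hP : P.degree < (2 * n : ℕ)) :
    ∫ t, P.eval t ∂μ =
      ∑ j, (∫ t, (Lagrange.basis Finset.univ x j).eval t ∂μ) * P.eval (x j) := by
  set q := Lagrange.nodal Finset.univ x with hq
  have hqm : q.Monic := Lagrange.nodal_monic
  have hqn : q.natDegree = n := by rw [hq, Lagrange.natDegree_nodal]; simp
  have hdecomp := modByMonic_add_div P q
  have hr : (P /ₘ q).degree < n := by
    by_cases h0 : P /ₘ q = 0
    · rw [h0, degree_zero]; exact WithBot.bot_lt_coe n
    have hP0 : P ≠ 0 := by rintro rfl; simp at h0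
    rw [degree_eq_natDegree h0, natDegree_divByMonic P hqm, hqn]
    rw [degree_eq_natDegree hP0] at hP
    have hP' : P.natDegree < 2 * n := by exact_mod_cast hP
    have : P.natDegree - n < n := by omega
    exact_mod_cast this
  have hH : P %ₘ q = Lagrange.interpolate Finset.univ x fun j => P.eval (x j) := by
    refine Lagrange.eq_interpolate_of_eval_eq _ hx.injOn ?_ ?_
    · have := degree_modByMonic_lt P hqm
      rwa [degree_eq_natDegree hqm.ne_zero, hqn, ← Fintype.card_fin n] at this
    · intro j hj
      conv_rhs => rw [← hdecomp]
      simp [hq, Lagrange.eval_nodal_at_node hj]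
  have hsplit : ∀ t, P.eval t = (P %ₘ q).eval t + (q * (P /ₘ q)).eval t := fun t => by
    rw [← eval_add, hdecomp]
  simp_rw [hsplit]
  rw [integral_add (hint _) (hint _), horth _ hr, add_zero, hH]
  simp only [Lagrange.interpolate_apply, eval_finsetSum, eval_mul, eval_C]
  rw [integral_finsetSum _ fun j _ => (hint _).const_mul _]
  refine Finset.sum_congr rfl fun j hj => ?_
  rw [integral_const_mul, mul_comm, hq, Lagrange.eval_nodal_at_node hj, zero_mul, add_zero]
  congr 1
  -- `hsplit` also rewrote the nodal values of `P` on the right; the interpolant at node `j`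
  -- collapses back to P(x_j).
  rw [Finset.sum_eq_single j]
  · rw [Lagrange.eval_basis_self hx.injOn hj, mul_one]
  · intro i _ hij
    rw [Lagrange.eval_basis_of_ne hij hj, mul_zero]
  · simp

/-- The product has degree 2n - 2, so the quadrature is exact, and ℓ_i ℓ_j vanishes at every node
unless i = j. The diagonal case shows that the weights are nonnegative. -/
theorem integral_basis_mul_basis (hx : Function.Injective x)
    (hint : ∀ P : ℝ[X], Integrable (fun t => P.eval t) μ)
    (horth : ∀ r : ℝ[X], r.degree < n →
      ∫ t, (Lagrange.nodal Finset.univ x * r).eval t ∂μ = 0) (i j : Fin n) :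
    ∫ t, (Lagrange.basis Finset.univ x i).eval t * (Lagrange.basis Finset.univ x j).eval t ∂μ =
      if i = j then ∫ t, (Lagrange.basis Finset.univ x i).eval t ∂μ else 0 := by
  have hn := i.pos
  simp_rw [← eval_mul]
  rw [integral_eval_eq_sum_gauss hx hint horth]
  · rw [Finset.sum_eq_single i]
    · split_ifs with h
      · subst h
        rw [eval_mul, Lagrange.eval_basis_self hx.injOn (Finset.mem_univ _)]; simp
      · rw [eval_mul, Lagrange.eval_basis_of_ne (Ne.symm h) (Finset.mem_univ _)]; simp
    · intro k _ hk
      rw [eval_mul, Lagrange.eval_basis_of_ne hk.symm (Finset.mem_univ _)]; simp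
    · simp
  · rw [degree_mul, Lagrange.degree_basis hx.injOn (Finset.mem_univ _),
      Lagrange.degree_basis hx.injOn (Finset.mem_univ _), Finset.card_univ, Fintype.card_fin]
    have : n - 1 + (n - 1) < 2 * n := by omega
    exact_mod_cast this

/-- Gaussian quadrature underestimates polynomials with nonnegative derivative of order `2 n`. -/
theorem sum_gauss_le_integral_eval (hx : Function.Injective x)
    (hint : ∀ P : ℝ[X], Integrable (fun t => P.eval t) μ)
    (horth : ∀ r : ℝ[X], r.degree < n →
      ∫ t, (Lagrange.nodal Finset.univ x * r).eval t ∂μ = 0)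
    {f : ℝ[X]} (hf : ∀ t, 0 ≤ (derivative^[2 * n] f).eval t) :
    ∑ j, (∫ t, (Lagrange.basis Finset.univ x j).eval t ∂μ) * f.eval (x j) ≤
      ∫ t, f.eval t ∂μ := by
  set q := Lagrange.nodal Finset.univ x with hq
  have hqm : q.Monic := Lagrange.nodal_monic
  have hq2 : (q ^ 2).Monic := hqm.pow 2
  have hdeg : (f %ₘ (q ^ 2)).degree < (2 * n : ℕ) := by
    have := degree_modByMonic_lt f hq2
    rwa [degree_eq_natDegree hq2.ne_zero, hqm.natDegree_pow, hq, Lagrange.natDegree_nodal,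
      Finset.card_univ, Fintype.card_fin] at this
  calc _ = ∑ j, (∫ t, (Lagrange.basis Finset.univ x j).eval t ∂μ) *
        (f %ₘ (q ^ 2)).eval (x j) := by
        refine Finset.sum_congr rfl fun j hj => ?_
        congr 1
        -- q² vanishes at the nodes, so `f` and its remainder agree there.
        conv_lhs => rw [← modByMonic_add_div f (q ^ 2)]
        simp [hq, Lagrange.eval_nodal_at_node hj]
    _ = ∫ t, (f %ₘ (q ^ 2)).eval t ∂μ := (integral_eval_eq_sum_gauss hx hint horth hdeg).symm
    _ ≤ _ := integral_mono (hint _) (hint _) (eval_modByMonic_nodal_sq_le x hf)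

/-- Gaussian quadrature underestimates the integral of `t ↦ exp (a t²)` for `a ≥ 0`. -/
theorem sum_gauss_exp_le_integral (hx : Function.Injective x)
    (hint : ∀ P : ℝ[X], Integrable (fun t => P.eval t) μ)
    (horth : ∀ r : ℝ[X], r.degree < n →
      ∫ t, (Lagrange.nodal Finset.univ x * r).eval t ∂μ = 0)
    {a : ℝ} (ha : 0 ≤ a) (hexp : Integrable (fun t => Real.exp (a * t ^ 2)) μ) :
    ∑ j, (∫ t, (Lagrange.basis Finset.univ x j).eval t ∂μ) * Real.exp (a * x j ^ 2) ≤
      ∫ t, Real.exp (a * t ^ 2) ∂μ := by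
  -- Taylor polynomials of exp(at²): the quadrature inequality holds for each of them and passes to
  -- the limit.
  let f : ℕ → ℝ[X] := fun N =>
    ∑ k ∈ Finset.range N, C (a ^ k / (k.factorial : ℝ)) * X ^ (2 * k)
  have hev : ∀ N t, (f N).eval t = ∑ k ∈ Finset.range N, (a * t ^ 2) ^ k / (k.factorial : ℝ) := by
    intro N t
    simp only [f, eval_finsetSum, eval_mul, eval_C, eval_pow, eval_X]
    refine Finset.sum_congr rfl fun k _ => ?_
    rw [mul_pow, ← pow_mul]; ring
  have hder : ∀ N t, 0 ≤ (derivative^[2 * n] (f N)).eval t := by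
    intro N t
    simp only [f, iterate_derivative_sum, iterate_derivative_C_mul,
      iterate_derivative_X_pow_eq_C_mul, eval_finsetSum, eval_mul, eval_C, eval_pow, eval_X]
    refine Finset.sum_nonneg fun k _ => ?_
    -- The exponent 2k - 2n is even, so the power of t is nonnegative. For k < n the subtraction
    -- truncates, but the descending factorial is zero.
    rw [← Nat.mul_sub, pow_mul]
    positivity
  have hlim : ∀ t, Filter.Tendsto (fun N => (f N).eval t) Filter.atTop
      (nhds (Real.exp (a * t ^ 2))) := by
    intro t
    simp_rw [hev]
    rw [Real.exp_eq_exp_ℝ]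
    exact (NormedSpace.expSeries_div_hasSum_exp (a * t ^ 2)).tendsto_sum_nat
  refine le_of_tendsto' (tendsto_finsetSum _ fun j _ => (hlim (x j)).const_mul _) fun N => ?_
  refine (sum_gauss_le_integral_eval hx hint horth (hder N)).trans
    (integral_mono (hint _) hexp fun t => ?_)
  simp only [hev]
  exact Real.sum_le_exp_of_nonneg (by positivity) N

/-- The double root at coinciding nodes forces the measure to vanish. -/
theorem measure_eq_zero_of_not_injective (hx : ¬ Function.Injective x) [NullSingletonClass μ]
    (hint : ∀ P : ℝ[X], Integrable (fun t => P.eval t) μ)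
    (horth : ∀ r : ℝ[X], r.degree < n →
      ∫ t, (Lagrange.nodal Finset.univ x * r).eval t ∂μ = 0) : μ = 0 := by
  classical
  obtain ⟨i, j, hij, hne⟩ : ∃ i j, x i = x j ∧ i ≠ j := by
    simpa [Function.Injective] using hx
  -- Dropping both copies of the double node leaves degree n - 2, and the nodal polynomial times `r`
  -- is a perfect square. Its integral vanishes, so μ is carried by finitely many points, a null
  -- set.
  set r := Lagrange.nodal ((Finset.univ.erase i).erase j) x with hr
  have hji : j ∈ Finset.univ.erase i := Finset.mem_erase.2 ⟨hne.symm, Finset.mem_univ _⟩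
  have hnod : Lagrange.nodal Finset.univ x = (X - C (x j)) ^ 2 * r := by
    rw [Lagrange.nodal_eq_mul_nodal_erase (Finset.mem_univ i), Lagrange.nodal_eq_mul_nodal_erase hji,
      hij]
    ring
  have hrd : r.degree < n := by
    rw [hr, Lagrange.degree_nodal]
    have h1 := Finset.card_lt_card (Finset.erase_ssubset hji)
    have h2 := Finset.card_lt_card (Finset.erase_ssubset (Finset.mem_univ i))
    rw [Finset.card_univ, Fintype.card_fin] at h2
    exact_mod_cast h1.trans h2
  have h0 := horth r hrd
  have hsq : ∀ t, (Lagrange.nodal Finset.univ x * r).eval t = (((X - C (x j)) * r).eval t) ^ 2 := by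
    intro t
    rw [hnod]; simp only [eval_mul, eval_pow]; ring
  rw [integral_eq_zero_iff_of_nonneg (fun t => by simp only [hsq]; exact sq_nonneg _) (hint _)] at h0
  have hP : (X - C (x j)) * r ≠ 0 :=
    mul_ne_zero (X_sub_C_ne_zero _) Lagrange.nodal_ne_zero
  have hfin : μ {t | ((X - C (x j)) * r).eval t = 0} = 0 := by
    refine Set.Finite.measure_zero (((X - C (x j)) * r).roots.toFinset.finite_toSet.subset ?_) μ
    intro t ht
    simpa [hP] using ht
  rw [← ae_eq_bot, ← Filter.eventually_false_iff_eq_bot]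
  filter_upwards [h0, measure_eq_zero_iff_ae_notMem.1 hfin] with t h1 h2
  rw [hsq] at h1
  exact h2 (by simpa using h1)

/-- Off-diagonal terms vanish in the norm of a Lagrange interpolant at Gauss nodes. -/
theorem norm_sum_basis_smul_sq {V : Type*} [NormedAddCommGroup V] [InnerProductSpace ℝ V]
    (hx : Function.Injective x)
    (hint : ∀ P : ℝ[X], Integrable (fun t => P.eval t) μ)
    (horth : ∀ r : ℝ[X], r.degree < n →
      ∫ t, (Lagrange.nodal Finset.univ x * r).eval t ∂μ = 0)
    (v : Fin n → V)
    (e : Fin n → Lp V 2 μ)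
    (he : ∀ j, e j =ᵐ[μ] fun t => (Lagrange.basis Finset.univ x j).eval t • v j) :
    ‖∑ j, e j‖ ^ 2 = ∑ j, (∫ t, (Lagrange.basis Finset.univ x j).eval t ∂μ) * ‖v j‖ ^ 2 := by
  have hinner : ∀ i j, inner ℝ (e i) (e j) =
      (if i = j then ∫ t, (Lagrange.basis Finset.univ x i).eval t ∂μ else 0) *
        inner ℝ (v i) (v j) := by
    intro i j
    rw [← integral_basis_mul_basis hx hint horth i j, L2.inner_def, ← integral_mul_const]
    refine integral_congr_ae ?_
    filter_upwards [he i, he j] with t hi hj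
    rw [hi, hj, real_inner_smul_left, real_inner_smul_right, mul_assoc]
  rw [← real_inner_self_eq_norm_sq, sum_inner]
  refine Finset.sum_congr rfl fun i _ => ?_
  rw [inner_sum, Finset.sum_eq_single i]
  · rw [hinner, if_pos rfl, real_inner_self_eq_norm_sq]
  · intro j _ hj
    rw [hinner, if_neg hj.symm, zero_mul]
  · simp

end Quadrature

/-! ### Integrability and orthogonality for the weight ρ. -/

theorem Polynomial.integrable_eval_mul_exp_neg_mul_sq {b : ℝ} (hb : 0 < b) (P : ℝ[X]) :
    Integrable fun t => P.eval t * Real.exp (-b * t ^ 2) := by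
  simp_rw [eval_eq_sum_range, Finset.sum_mul]
  refine integrable_finsetSum _ fun k _ => ?_
  have h := (integrable_rpow_mul_exp_neg_mul_sq hb (s := k)
    (by have : (0 : ℝ) ≤ k := k.cast_nonneg
        linarith)).const_mul (P.coeff k)
  simpa only [Real.rpow_natCast, mul_assoc] using h

section Weight

variable {Γ : Set ℝ} {δ : ℝ} {ρ : ℝ → ℝ} {CM : ℝ}

theorem Polynomial.integrableOn_eval_mul_exp
    (hδ_unbdd : ¬ Bornology.IsBounded Γ → 0 < δ) (P : ℝ[X]) :
    IntegrableOn (fun t => P.eval t * Real.exp (-(δ ^ 2 / 2) * t ^ 2)) Γ := by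
  by_cases hb : Bornology.IsBounded Γ
  · refine IntegrableOn.mono_set (t := closure Γ) ?_ subset_closure
    have hc : Continuous fun t => P.eval t * Real.exp (-(δ ^ 2 / 2) * t ^ 2) := by fun_prop
    exact hc.continuousOn.integrableOn_compact hb.isCompact_closure
  · have := hδ_unbdd hb
    exact (integrable_eval_mul_exp_neg_mul_sq (by positivity) P).integrableOn

theorem integrable_weightMeasure_iff (hΓ : MeasurableSet Γ)
    (hρ_meas : AEMeasurable ρ (volume.restrict Γ)) (hρ_nonneg : ∀ y ∈ Γ, 0 ≤ ρ y) {g : ℝ → ℝ} :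
    Integrable g (weightMeasure Γ ρ) ↔ IntegrableOn (fun t => ρ t * g t) Γ := by
  rw [weightMeasure, integrable_withDensity_iff_integrable_smul₀' hρ_meas.ennreal_ofReal
    (Filter.Eventually.of_forall fun t => ENNReal.ofReal_lt_top)]
  refine integrable_congr ?_
  filter_upwards [ae_restrict_mem hΓ] with t ht
  rw [ENNReal.toReal_ofReal (hρ_nonneg t ht), smul_eq_mul]

theorem integral_weightMeasure (hΓ : MeasurableSet Γ)
    (hρ_meas : AEMeasurable ρ (volume.restrict Γ)) (hρ_nonneg : ∀ y ∈ Γ, 0 ≤ ρ y) (g : ℝ → ℝ) :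
    ∫ t, g t ∂weightMeasure Γ ρ = ∫ t in Γ, ρ t * g t := by
  rw [weightMeasure, integral_withDensity_eq_integral_toReal_smul₀ hρ_meas.ennreal_ofReal
    (Filter.Eventually.of_forall fun t => ENNReal.ofReal_lt_top)]
  refine integral_congr_ae ?_
  filter_upwards [ae_restrict_mem hΓ] with t ht
  rw [ENNReal.toReal_ofReal (hρ_nonneg t ht), smul_eq_mul]

/-- Half of the Gaussian decay of ρ absorbs the growing exponential; the remaining exp(-δ²t²/2)
controls the polynomial. -/
theorem Polynomial.integrable_weightMeasure_eval_mul_exp (hΓ : MeasurableSet Γ)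
    (hδ_unbdd : ¬ Bornology.IsBounded Γ → 0 < δ)
    (hρ_meas : AEMeasurable ρ (volume.restrict Γ)) (hρ_nonneg : ∀ y ∈ Γ, 0 ≤ ρ y)
    (hρ_le : ∀ y ∈ Γ, ρ y ≤ CM * Real.exp (-(δ * y) ^ 2)) (P : ℝ[X]) :
    Integrable (fun t => P.eval t * Real.exp (δ ^ 2 / 2 * t ^ 2)) (weightMeasure Γ ρ) := by
  rw [integrable_weightMeasure_iff hΓ hρ_meas hρ_nonneg]
  refine ((integrableOn_eval_mul_exp hδ_unbdd P).const_mul CM).mono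
    (hρ_meas.aestronglyMeasurable.mul (by fun_prop)) ?_
  filter_upwards [ae_restrict_mem hΓ] with t ht
  have h1 := hρ_nonneg t ht
  have h2 := (hρ_le t ht).trans (mul_le_mul_of_nonneg_right (le_abs_self CM) (Real.exp_pos _).le)
  have h3 : Real.exp (-(δ * t) ^ 2) * Real.exp (δ ^ 2 / 2 * t ^ 2) =
      Real.exp (-(δ ^ 2 / 2) * t ^ 2) := by
    rw [← Real.exp_add]; congr 1; ring
  simp only [norm_mul, Real.norm_eq_abs, Real.abs_exp, abs_of_nonneg h1, ← h3]
  calc _ ≤ |CM| * Real.exp (-(δ * t) ^ 2) * (|P.eval t| * Real.exp (δ ^ 2 / 2 * t ^ 2)) := by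
        gcongr
    _ = _ := by ring

theorem Polynomial.integrable_weightMeasure_eval (hΓ : MeasurableSet Γ)
    (hδ_unbdd : ¬ Bornology.IsBounded Γ → 0 < δ)
    (hρ_meas : AEMeasurable ρ (volume.restrict Γ)) (hρ_nonneg : ∀ y ∈ Γ, 0 ≤ ρ y)
    (hρ_le : ∀ y ∈ Γ, ρ y ≤ CM * Real.exp (-(δ * y) ^ 2)) (P : ℝ[X]) :
    Integrable (fun t => P.eval t) (weightMeasure Γ ρ) := by
  refine (integrable_weightMeasure_eval_mul_exp hΓ hδ_unbdd hρ_meas hρ_nonneg hρ_le P).mono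
    P.continuous.aestronglyMeasurable (Filter.Eventually.of_forall fun t => ?_)
  rw [norm_mul]
  refine le_mul_of_one_le_right (norm_nonneg _) ?_
  rw [Real.norm_eq_abs, Real.abs_exp]
  exact Real.one_le_exp (by positivity)

/-- The nodal polynomial of Gauss nodes is orthogonal to all polynomials of lower degree. -/
theorem IsGaussNodes.integral_nodal_mul_eq_zero (hΓ : MeasurableSet Γ)
    (hρ_meas : AEMeasurable ρ (volume.restrict Γ)) (hρ_nonneg : ∀ y ∈ Γ, 0 ≤ ρ y) {p : ℕ}
    {y : Fin (p + 1) → Γ} (hy : IsGaussNodes Γ ρ p y) {r : ℝ[X]}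
    (hr : r.degree < (p + 1 : ℕ)) :
    ∫ t, (Lagrange.nodal Finset.univ (fun j => (y j : ℝ)) * r).eval t ∂weightMeasure Γ ρ = 0 := by
  obtain ⟨q, hqdeg, hq, hroots⟩ := hy
  have hlc : q.leadingCoeff ≠ 0 := by
    rw [Ne, leadingCoeff_eq_zero]
    rintro rfl
    simp at hqdeg
  have hqn : q = C q.leadingCoeff * Lagrange.nodal Finset.univ (fun j => (y j : ℝ)) := by
    -- There are as many nodes as the degree of `q`, so `q` splits and is a nonzero multiple of the
    -- nodal polynomial.
    have h := C_leadingCoeff_mul_prod_multiset_X_sub_C (p := q) (by rw [hroots, hqdeg]; simp)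
    rw [hroots, Multiset.map_map] at h
    exact h.symm
  have hrn : r.natDegree ≤ p := by
    rw [← Nat.lt_succ_iff]
    by_cases h0 : r = 0
    · simp [h0]
    · exact (natDegree_lt_iff_degree_lt h0).2 hr
  have h := hq r hrn
  rw [integral_weightMeasure hΓ hρ_meas hρ_nonneg]
  refine (mul_eq_zero.1 ?_).resolve_left hlc
  rw [← integral_const_mul, ← h]
  congr 1 with t
  conv_rhs => rw [hqn]
  simp only [eval_mul, eval_C]
  ring

end Weight

/-! ### The interpolation operator and its norm bound. -/

/-- The Lagrange interpolation operator with values in `L²(μ; V)`. -/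
noncomputable def interpLinearMap {δ : ℝ} {Γ : Set ℝ} {V : Type*} [NormedAddCommGroup V]
    [NormedSpace ℝ V] {n : ℕ} (y : Fin n → Γ) {μ : Measure ℝ} (b : Fin n → Lp ℝ 2 μ) :
    WeightedC0 δ Γ V →ₗ[ℝ] Lp V 2 μ where
  toFun v := ∑ j, (ContinuousLinearMap.toSpanSingleton ℝ ((v : Γ → V) (y j))).compLp (b j)
  map_add' v w := by
    simp only [Submodule.coe_add, Pi.add_apply, ContinuousLinearMap.toSpanSingleton_add,
      ContinuousLinearMap.add_compLp, Finset.sum_add_distrib]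
  map_smul' c v := by
    simp only [Submodule.coe_smul, Pi.smul_apply, ContinuousLinearMap.toSpanSingleton_smul,
      ContinuousLinearMap.smul_compLp, Finset.smul_sum, RingHom.id_apply]

theorem sq_norm_le_exp_mul {δ : ℝ} {Γ : Set ℝ} {V : Type*} [NormedAddCommGroup V]
    [NormedSpace ℝ V] (v : WeightedC0 δ Γ V) (y : Γ) :
    ‖(v : Γ → V) y‖ ^ 2 ≤ Real.exp (δ ^ 2 / 2 * (y : ℝ) ^ 2) * ‖v‖ ^ 2 := by
  have h := pow_le_pow_left₀ (mul_nonneg (varsigma_pos δ y).le (norm_nonneg _)) (WeightedC0.le_norm v y) 2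
  have h2 : varsigma δ y ^ 2 * Real.exp (δ ^ 2 / 2 * (y : ℝ) ^ 2) = 1 := by
    rw [varsigma, ← Real.exp_nat_mul, ← Real.exp_add, Real.exp_eq_one_iff]
    push_cast; ring
  calc ‖(v : Γ → V) y‖ ^ 2
      = Real.exp (δ ^ 2 / 2 * (y : ℝ) ^ 2) * (varsigma δ y * ‖(v : Γ → V) y‖) ^ 2 := by
        rw [mul_pow, ← mul_assoc, mul_comm (Real.exp _), h2, one_mul]
    _ ≤ _ := by gcongr

section Operator

variable {δ : ℝ} {Γ : Set ℝ} {V : Type*} [NormedAddCommGroup V] [InnerProductSpace ℝ V] {n : ℕ}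
  {μ : Measure ℝ} (y : Fin n → Γ) (b : Fin n → Lp ℝ 2 μ)

theorem compLp_toSpanSingleton_ae_eq {f : ℝ → ℝ} {g : Lp ℝ 2 μ} (hg : g =ᵐ[μ] f) (c : V) :
    (ContinuousLinearMap.toSpanSingleton ℝ c).compLp g =ᵐ[μ] fun t => f t • c := by
  filter_upwards [(ContinuousLinearMap.toSpanSingleton ℝ c).coeFn_compLp g, hg] with t h1 h2
  rw [h1, h2, ContinuousLinearMap.toSpanSingleton_apply]

theorem continuous_compLp_toSpanSingleton (g : Lp ℝ 2 μ) :
    Continuous fun c : V => (ContinuousLinearMap.toSpanSingleton ℝ c).compLp g := by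
  let L : V →ₗ[ℝ] Lp V 2 μ :=
    { toFun := fun c => (ContinuousLinearMap.toSpanSingleton ℝ c).compLp g
      map_add' := fun c d => by
        rw [ContinuousLinearMap.toSpanSingleton_add, ContinuousLinearMap.add_compLp]
      map_smul' := fun a c => by
        rw [ContinuousLinearMap.toSpanSingleton_smul, ContinuousLinearMap.smul_compLp,
          RingHom.id_apply] }
  refine (L.mkContinuous ‖g‖ fun c => ?_).continuous
  refine (ContinuousLinearMap.norm_compLp_le _ _).trans ?_
  rw [ContinuousLinearMap.norm_toSpanSingleton, mul_comm]

/-- The interpolation operator is continuous even for pointwise convergence on `Γ`, which is the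
topology that `WeightedC0 δ Γ V` inherits from `Γ → V`. -/
theorem continuous_interpLinearMap :
    Continuous (interpLinearMap y b : WeightedC0 δ Γ V → Lp V 2 μ) := by
  have h : Continuous fun v : WeightedC0 δ Γ V => ∑ j,
      (ContinuousLinearMap.toSpanSingleton ℝ ((v : Γ → V) (y j))).compLp (b j) :=
    continuous_finsetSum _ fun j _ => (continuous_compLp_toSpanSingleton (b j)).comp
      ((continuous_apply (y j)).comp continuous_subtype_val)
  exact h

theorem interpLinearMap_ae_eq
    (hb : ∀ j, b j =ᵐ[μ] fun t => (Lagrange.basis Finset.univ (fun k => (y k : ℝ)) j).eval t)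
    (v : WeightedC0 δ Γ V) :
    interpLinearMap y b v =ᵐ[μ] fun t =>
      ∑ j, (Lagrange.basis Finset.univ (fun k => (y k : ℝ)) j).eval t • (v : Γ → V) (y j) := by
  have hall := ae_all_iff.2 fun j => compLp_toSpanSingleton_ae_eq (hb j) ((v : Γ → V) (y j))
  filter_upwards [hall, Lp.coeFn_fun_finsetSum Finset.univ fun j =>
    (ContinuousLinearMap.toSpanSingleton ℝ ((v : Γ → V) (y j))).compLp (b j)] with t h1 h2
  exact h2.trans (Finset.sum_congr rfl fun j _ => h1 j)

theorem sq_norm_interpLinearMap_le (hy : Function.Injective fun j => (y j : ℝ))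
    (hint : ∀ P : ℝ[X], Integrable (fun t => P.eval t) μ)
    (horth : ∀ r : ℝ[X], r.degree < n →
      ∫ t, (Lagrange.nodal Finset.univ (fun j => (y j : ℝ)) * r).eval t ∂μ = 0)
    (hexp : Integrable (fun t => Real.exp (δ ^ 2 / 2 * t ^ 2)) μ)
    (hb : ∀ j, b j =ᵐ[μ] fun t => (Lagrange.basis Finset.univ (fun k => (y k : ℝ)) j).eval t)
    (v : WeightedC0 δ Γ V) :
    ‖interpLinearMap y b v‖ ^ 2 ≤ (∫ t, Real.exp (δ ^ 2 / 2 * t ^ 2) ∂μ) * ‖v‖ ^ 2 := by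
  set x : Fin n → ℝ := fun j => (y j : ℝ) with hx
  calc ‖interpLinearMap y b v‖ ^ 2
      = ∑ j, (∫ t, (Lagrange.basis Finset.univ x j).eval t ∂μ) * ‖(v : Γ → V) (y j)‖ ^ 2 :=
        norm_sum_basis_smul_sq hy hint horth _ _ fun j => compLp_toSpanSingleton_ae_eq (hb j) _
    _ ≤ ∑ j, (∫ t, (Lagrange.basis Finset.univ x j).eval t ∂μ) *
          (Real.exp (δ ^ 2 / 2 * x j ^ 2) * ‖v‖ ^ 2) := by
        refine Finset.sum_le_sum fun j _ =>
          mul_le_mul_of_nonneg_left (sq_norm_le_exp_mul v (y j)) ?_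
        -- The weight equals ∫ ℓ_j² dμ, hence is nonnegative.
        have h := integral_basis_mul_basis hy hint horth j j
        rw [if_pos rfl] at h
        rw [← h]
        exact integral_nonneg fun t => mul_self_nonneg _
    _ = (∑ j, (∫ t, (Lagrange.basis Finset.univ x j).eval t ∂μ) *
          Real.exp (δ ^ 2 / 2 * x j ^ 2)) * ‖v‖ ^ 2 := by
        simp_rw [Finset.sum_mul, mul_assoc]
    _ ≤ _ := mul_le_mul_of_nonneg_right
        (sum_gauss_exp_le_integral hy hint horth (by positivity) hexp) (sq_nonneg _)

theorem norm_interpLinearMap_le [NullSingletonClass μ]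
    (hint : ∀ P : ℝ[X], Integrable (fun t => P.eval t) μ)
    (horth : ∀ r : ℝ[X], r.degree < n →
      ∫ t, (Lagrange.nodal Finset.univ (fun j => (y j : ℝ)) * r).eval t ∂μ = 0)
    (hexp : Integrable (fun t => Real.exp (δ ^ 2 / 2 * t ^ 2)) μ)
    (hb : ∀ j, b j =ᵐ[μ] fun t => (Lagrange.basis Finset.univ (fun k => (y k : ℝ)) j).eval t)
    (v : WeightedC0 δ Γ V) :
    ‖interpLinearMap y b v‖ ≤ √(∫ t, Real.exp (δ ^ 2 / 2 * t ^ 2) ∂μ) * ‖v‖ := by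
  have hK : 0 ≤ ∫ t, Real.exp (δ ^ 2 / 2 * t ^ 2) ∂μ :=
    integral_nonneg fun t => (Real.exp_pos _).le
  by_cases hy : Function.Injective fun j => (y j : ℝ)
  · refine _root_.le_of_sq_le_sq ?_ (by positivity)
    rw [mul_pow, Real.sq_sqrt hK]
    exact sq_norm_interpLinearMap_le y b hy hint horth hexp hb v
  · have h0 : μ = 0 := measure_eq_zero_of_not_injective hy hint horth
    have h1 : interpLinearMap y b v = 0 := by
      apply Lp.ext
      simp only [h0, ae_zero]
      trivial
    rw [h1, norm_zero]
    positivity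

theorem exists_interp_operator [NullSingletonClass μ]
    (hint : ∀ P : ℝ[X], Integrable (fun t => P.eval t) μ)
    (hexp : Integrable (fun t => Real.exp (δ ^ 2 / 2 * t ^ 2)) μ)
    {p : ℕ} (y : Fin (p + 1) → Γ)
    (horth : ∀ r : ℝ[X], r.degree < (p + 1 : ℕ) →
      ∫ t, (Lagrange.nodal Finset.univ (fun j => (y j : ℝ)) * r).eval t ∂μ = 0) :
    ∃ I : WeightedC0 δ Γ V →L[ℝ] Lp V 2 μ,
      (∀ v : WeightedC0 δ Γ V, I v =ᵐ[μ] lagrangeInterp y (v : Γ → V)) ∧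
      ∀ v : WeightedC0 δ Γ V, ‖I v‖ ≤ √(∫ t, Real.exp (δ ^ 2 / 2 * t ^ 2) ∂μ) * ‖v‖ := by
  have hmem : ∀ j, MemLp
      (fun t => (Lagrange.basis Finset.univ (fun k => (y k : ℝ)) j).eval t) 2 μ := fun j => by
    rw [memLp_two_iff_integrable_sq (Polynomial.continuous _).aestronglyMeasurable]
    have h := hint (Lagrange.basis Finset.univ (fun k => (y k : ℝ)) j ^ 2)
    simp_rw [eval_pow] at h
    exact h
  obtain ⟨b, hb⟩ : ∃ b : Fin (p + 1) → Lp ℝ 2 μ, ∀ j, b j =ᵐ[μ]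
      fun t => (Lagrange.basis Finset.univ (fun k => (y k : ℝ)) j).eval t :=
    ⟨fun j => (hmem j).toLp _, fun j => (hmem j).coeFn_toLp⟩
  have hbound := norm_interpLinearMap_le (V := V) y b hint horth hexp hb
  exact ⟨⟨interpLinearMap y b, continuous_interpLinearMap y b⟩, interpLinearMap_ae_eq y b hb, hbound⟩

end Operator

theorem mainTheorem7
    {V : Type*} [NormedAddCommGroup V] [InnerProductSpace ℝ V] [CompleteSpace V]
    (Γ : Set ℝ) (hΓ : MeasurableSet Γ)
    (δ : ℝ) (hδ_bdd : Bornology.IsBounded Γ → δ = 0) (hδ_unbdd : ¬ Bornology.IsBounded Γ → 0 < δ)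
    (ρ : ℝ → ℝ) (hρ_meas : AEMeasurable ρ (volume.restrict Γ)) (hρ_nonneg : ∀ y ∈ Γ, 0 ≤ ρ y)
    (CM : ℝ) (hCM : 0 < CM) (hρ_le : ∀ y ∈ Γ, ρ y ≤ CM * Real.exp (-(δ * y) ^ 2)) :
    ∃ C : ℝ, 0 < C ∧
      ∀ (p : ℕ) (y : Fin (p + 1) → Γ), IsGaussNodes Γ ρ p y →
        ∃ I : WeightedC0 δ Γ V →L[ℝ] Lp V 2 (weightMeasure Γ ρ),
          (∀ v : WeightedC0 δ Γ V,
            I v =ᵐ[weightMeasure Γ ρ] lagrangeInterp y (v : Γ → V)) ∧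
          ∀ v : WeightedC0 δ Γ V, ‖I v‖ ≤ C * ‖v‖ := by
  have hatom : NullSingletonClass (weightMeasure Γ ρ) := by rw [weightMeasure]; infer_instance
  have hint : ∀ P : ℝ[X], Integrable (fun t => P.eval t) (weightMeasure Γ ρ) :=
    integrable_weightMeasure_eval hΓ hδ_unbdd hρ_meas hρ_nonneg hρ_le
  have hexp : Integrable (fun t => Real.exp (δ ^ 2 / 2 * t ^ 2)) (weightMeasure Γ ρ) := by
    simpa using integrable_weightMeasure_eval_mul_exp hΓ hδ_unbdd hρ_meas hρ_nonneg hρ_le 1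
  -- The integral does not involve p or the nodes. Adding 1 keeps the constant positive even if ρ =
  -- 0 a.e. on Γ.
  refine ⟨√(∫ t, Real.exp (δ ^ 2 / 2 * t ^ 2) ∂weightMeasure Γ ρ) + 1, by positivity,
    fun p y hy => ?_⟩
  obtain ⟨I, hI, hle⟩ := exists_interp_operator (V := V) hint hexp y fun r hr =>
    hy.integral_nodal_mul_eq_zero hΓ hρ_meas hρ_nonneg hr
  refine ⟨I, hI, fun v => (hle v).trans ?_⟩
  exact mul_le_mul_of_nonneg_right (le_add_of_nonneg_right zero_le_one) (norm_nonneg v)
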